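/- All graphs are finite and simple. A graph is chordal if every cycle of length at least $4$ has a chord, and it is a circular-arc graph if it is the intersection graph of a family of arcs of a circle. A vertex misses a path if it has no neighbour on the path. Vertices $x,y$ avoid vertices $z,w$ if there is an $xy$-path missed by both $z$ and $w$, or a $zw$-path missed by both $x$ and $y$. Four distinct vertices $x,y,z,w$ form a blocking quadruple if $x,y$ avoid $z,w$, and $x,z$ avoid $y,w$, and $x,w$ avoid $y,z$. Theorem. Let $G$ be a chordal graph with independence number $\alpha(G)\le 4$. Then $G$ is a circular-arc graph if and only if $G$ has no blocking quadruple. As a consequence, every chordal graph $G$ with $\alpha(G)\le 3$ is a circular-arc graph. -/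

import Mathlib

/-!  Chordal graphs, circular-arc graphs and blocking quadruples. -/

namespace SimpleGraph

variable {V : Type*}

/-- A graph is chordal if every cycle of length at least four has a chord: an edge of the graph
joining two vertices of the cycle that is not an edge of the cycle. -/
def IsChordal (G : SimpleGraph V) : Prop :=
  ∀ (v : V) (c : G.Walk v v), c.IsCycle → 4 ≤ c.length → ∃ e, c.IsChord e

/-- An arc of the unit circle: the set of the points `exp (i t)` with `a ≤ t ≤ b`, where
the length `b - a` is positive and less than `2 π`. -/
def IsCircleArc (S : Set Circle) : Prop :=
  ∃ a b : ℝ, a < b ∧ b < a + 2 * Real.pi ∧ S = Circle.exp '' Set.Icc a b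

/-- A circular-arc graph: the intersection graph of a family of arcs of a circle, indexed by
the vertices. -/
def IsCircularArc (G : SimpleGraph V) : Prop :=
  ∃ A : V → Set Circle, (∀ v, IsCircleArc (A v)) ∧
    ∀ u v, u ≠ v → (G.Adj u v ↔ (A u ∩ A v).Nonempty)

/-- The vertex `v` misses the walk `p`: it has no neighbour on `p`. -/
def Misses (G : SimpleGraph V) (v : V) {x y : V} (p : G.Walk x y) : Prop :=
  ∀ u ∈ p.support, ¬ G.Adj v u

/-- The vertices `x, y` avoid the vertices `z, w`: there is an `xy`-path missed by both `z` and
`w`, or a `zw`-path missed by both `x` and `y`. -/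
def Avoid (G : SimpleGraph V) (x y z w : V) : Prop :=
  (∃ p : G.Walk x y, p.IsPath ∧ G.Misses z p ∧ G.Misses w p) ∨
    (∃ p : G.Walk z w, p.IsPath ∧ G.Misses x p ∧ G.Misses y p)

/-- Four distinct vertices form a blocking quadruple if any two of them avoid the other two. -/
def IsBlockingQuadruple (G : SimpleGraph V) (x y z w : V) : Prop :=
  (x ≠ y ∧ x ≠ z ∧ x ≠ w ∧ y ≠ z ∧ y ≠ w ∧ z ≠ w) ∧
    G.Avoid x y z w ∧ G.Avoid x z y w ∧ G.Avoid x w y z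

end SimpleGraph

/-! Necessity. Choose a point on the arc of each vertex of a blocking quadruple. The arcs along a
path cover a connected set, and vertices that miss the path have their points outside it. So pairs
that avoid each other give pairs of points that do not separate each other on the circle
(`not_separated_of_isPreconnected`). But among the three pairings of four distinct points of a
circle, one always crosses.

Sufficiency. Without three independent simplicial vertices the graph is an interval graph
(`exists_interval_model`). Otherwise take three such vertices `xᵢ`. Their closed neighbourhoods are
cliques, and since `α ≤ 4`, so is the set `R` of the vertices outside all three. Call `u, v` from
two different neighbourhoods touching if they are equal or adjacent. The sets of touching pairs hit
by the vertices of `R` form a chain (`adj_of_touching_pairs`); let `r` have the smallest one. As the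
`xᵢ` and `r` do not block, some `xᵢ, r` do not avoid the other two. Hence `r`, and by minimality all
of `R`, hits every touching pair of the other two neighbourhoods outside `N[xᵢ]`, and vertices of
`N[xᵢ]` with neighbours in `R` lie in another neighbourhood.

Now `R` grows to a clique opposite to `N[xᵢ]` such that the four cliques cover all edges in circular
order. They become four corners of the circle. Between consecutive corners chordality makes
neighbourhoods nested, which tells how far each arc must reach (`exists_threshold`). -/

namespace SimpleGraph

variable {V : Type*} {G : SimpleGraph V}

/-! ### Chordless paths and simplicial vertices -/

/-- A walk within a set of vertices can be replaced by a chordless path within this set. -/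
theorem Walk.exists_isPath_chordless {W : Set V} {s t : V} (p : G.Walk s t)
    (hp : ∀ v ∈ p.support, v ∈ W) :
    ∃ q : G.Walk s t, q.IsPath ∧ (∀ v ∈ q.support, v ∈ W) ∧
      ∀ i j, i < j → j ≤ q.length → G.Adj (q.getVert i) (q.getVert j) → j = i + 1 := by
  classical
  have hex : ∃ n, ∃ q : G.Walk s t, (∀ v ∈ q.support, v ∈ W) ∧ q.length = n :=
    ⟨_, p, hp, rfl⟩
  obtain ⟨q, hqW, hqn⟩ := Nat.find_spec hex
  have hmin : ∀ q' : G.Walk s t, (∀ v ∈ q'.support, v ∈ W) → q.length ≤ q'.length := by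
    intro q' h
    rw [hqn]
    exact Nat.find_min' hex ⟨q', h, rfl⟩
  have hbW : ∀ v ∈ q.bypass.support, v ∈ W := fun v hv => hqW v (q.support_bypass_subset_support hv)
  refine ⟨q.bypass, q.bypass_isPath, hbW, ?_⟩
  intro i j hij hj hadj
  by_contra hne
  -- A chord would give a shortcut, contradicting the choice of `q` as a shortest walk in `W`.
  have h1 := hmin ((q.bypass.take i).append (Walk.cons hadj (q.bypass.drop j))) (by
    intro v hv
    rw [Walk.mem_support_append_iff, Walk.support_cons, List.mem_cons] at hv
    rcases hv with hv | rfl | hv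
    · exact hbW v (List.mem_of_mem_take (by rw [Walk.support_take] at hv; exact hv))
    · exact hbW _ (Walk.getVert_mem_support _ _)
    · rw [Walk.drop_support_eq_support_drop_min] at hv
      exact hbW v (List.mem_of_mem_drop hv))
  rw [Walk.length_append, Walk.length_cons, Walk.take_length, Walk.drop_length] at h1
  have := q.length_bypass_le_length
  omega

/-- Two neighbours `s, s'` of `t` joined by a walk whose other vertices are neither `t` nor
neighbours of `t` are adjacent. -/
theorem IsChordal.adj_of_walk (hG : G.IsChordal) {t s s' : V} (hs : G.Adj t s) (hs' : G.Adj t s')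
    (hne : s ≠ s') (p : G.Walk s s')
    (hp : ∀ v ∈ p.support, v = s ∨ v = s' ∨ (v ≠ t ∧ ¬ G.Adj t v)) : G.Adj s s' := by
  by_contra hns
  obtain ⟨q, hq, hqW, hqc⟩ := p.exists_isPath_chordless
    (W := {v | v = s ∨ v = s' ∨ (v ≠ t ∧ ¬ G.Adj t v)}) hp
  have htq : t ∉ q.support := by
    intro h
    rcases hqW t h with h | h | h
    · exact hs.ne h
    · exact hs'.ne h
    · exact h.1 rfl
  have hlen : 2 ≤ q.length := by
    by_contra hlt
    have : q.length = 0 ∨ q.length = 1 := by omega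
    rcases this with h | h
    · exact hne (Walk.eq_of_length_eq_zero h)
    · exact hns (Walk.adj_of_length_eq_one h)
  let c : G.Walk t t := Walk.cons hs (q.concat hs'.symm)
  have hc : c.IsCycle := by
    rw [Walk.cons_isCycle_iff]
    refine ⟨hq.concat htq _, ?_⟩
    rw [Walk.edges_concat, List.concat_eq_append, List.mem_append]
    rintro (h | h)
    · exact htq (Walk.fst_mem_support_of_mem_edges _ h)
    · simp only [List.mem_singleton, Sym2.eq_iff] at h
      rcases h with ⟨h, -⟩ | ⟨-, h⟩
      · exact hs'.ne h
      · exact hne h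
  obtain ⟨e, he⟩ := hG t c hc (by simp [c]; omega)
  have hsupp : ∀ v, v ∈ c.support ↔ v = t ∨ v ∈ q.support := by
    intro v; simp [c, Walk.support_concat]
    tauto
  have hedge : ∀ e, e ∈ c.edges ↔ e = s(t, s) ∨ e ∈ q.edges ∨ e = s(s', t) := by
    intro e; simp [c, Walk.edges_concat]
  have hqe : ∀ a ∈ q.support, ∀ b ∈ q.support, G.Adj a b → s(a, b) ∈ q.edges := by
    have key : ∀ i j, i < j → j ≤ q.length → G.Adj (q.getVert i) (q.getVert j) →
        s(q.getVert i, q.getVert j) ∈ q.edges := by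
      intro i j hij hj h
      obtain rfl := hqc i j hij hj h
      exact Walk.adj_toSubgraph_iff_mem_edges.1 (Walk.toSubgraph_adj_getVert q hj)
    intro a ha b hb hab
    obtain ⟨i, rfl, hi⟩ := Walk.mem_support_iff_exists_getVert.1 ha
    obtain ⟨j, rfl, hj⟩ := Walk.mem_support_iff_exists_getVert.1 hb
    rcases lt_trichotomy i j with h | h | h
    · exact key i j h hj hab
    · subst h; exact absurd hab (G.loopless.irrefl _)
    · rw [Sym2.eq_swap]; exact key j i h hi hab.symm
  have htn : ∀ b ∈ q.support, G.Adj t b → s(t, b) ∈ c.edges := by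
    intro b hb h
    rw [hedge]
    rcases hqW b hb with rfl | rfl | h'
    · exact Or.inl rfl
    · exact Or.inr (Or.inr Sym2.eq_swap)
    · exact absurd h h'.2
  induction e using Sym2.ind with
  | _ a b =>
    rw [Walk.isChord_sym2Mk] at he
    obtain ⟨hab, hn, ha, hb⟩ := he
    rw [hsupp] at ha hb
    rcases ha with rfl | ha
    · rcases hb with rfl | hb
      · exact hab.ne rfl
      · exact hn (htn b hb hab)
    · rcases hb with rfl | hb
      · exact hn (Sym2.eq_swap ▸ htn a ha hab.symm)
      · exact hn ((hedge _).2 (Or.inr (Or.inl (hqe a ha b hb hab))))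

/-- If a walk contains no neighbour of `t`, then any two neighbours of `t` with neighbours on the
walk are adjacent. -/
theorem IsChordal.adj_of_adj_walk (hG : G.IsChordal) {t s s' a b : V} (hs : G.Adj t s)
    (hs' : G.Adj t s') (hne : s ≠ s') (hsa : G.Adj s a) (hsb : G.Adj s' b) (p : G.Walk a b)
    (hp : ∀ v ∈ p.support, v ≠ t ∧ ¬ G.Adj t v) : G.Adj s s' := by
  refine hG.adj_of_walk hs hs' hne (Walk.cons hsa (p.concat hsb.symm)) ?_
  intro v hv
  simp only [Walk.support_cons, Walk.support_concat, List.mem_cons,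
    List.mem_append, List.not_mem_nil, or_false] at hv
  rcases hv with rfl | hv | rfl
  · exact Or.inl rfl
  · exact Or.inr (Or.inr (hp v hv))
  · exact Or.inr (Or.inl rfl)

theorem IsChordal.adj_of_four_cycle (hG : G.IsChordal) {a b c d : V} (hab : G.Adj a b)
    (hbc : G.Adj b c) (hcd : G.Adj c d) (hda : G.Adj d a) (hac : a ≠ c) (hbd : b ≠ d)
    (hn : ¬ G.Adj a c) : G.Adj b d :=
  hG.adj_of_adj_walk hab hda.symm hbd hbc hcd.symm Walk.nil (by
    intro v hv
    rw [Walk.support_nil, List.mem_singleton] at hv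
    subst hv
    exact ⟨hac.symm, hn⟩)

/-- The vertex `v` of `U` is simplicial in the subgraph induced by `U`. -/
def IsSimplicialIn (G : SimpleGraph V) (U : Set V) (v : V) : Prop :=
  v ∈ U ∧ ∀ a ∈ U, ∀ b ∈ U, G.Adj v a → G.Adj v b → a ≠ b → G.Adj a b

/-- Dirac: for every vertex `t` of a chordal graph that has a non-neighbour, there is a simplicial
vertex among its non-neighbours. -/
theorem IsChordal.exists_isSimplicialIn (hG : G.IsChordal) (U : Finset V) :
    ∀ t ∈ U, ∀ b ∈ U, b ≠ t → ¬ G.Adj t b →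
      ∃ v, G.IsSimplicialIn U v ∧ v ≠ t ∧ ¬ G.Adj t v := by
  classical
  induction U using Finset.strongInduction with
  | H U ih =>
  intro t ht b hb hbt htb
  let X : V → Prop := fun v => v ∈ U ∧ v ≠ t ∧ ¬ G.Adj t v
  -- `D` is the component of `b` among the non-neighbours of `t`; its boundary `S` below is a
  -- clique. Vertices of `D` have all their neighbours in `D ∪ S`, so being simplicial there
  -- suffices.
  let D : V → Prop := fun w => ∃ p : G.Walk b w, ∀ v ∈ p.support, X v
  have hDX : ∀ w, D w → X w := fun w ⟨p, hp⟩ => hp w p.end_mem_support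
  have hbD : D b := ⟨Walk.nil, by simpa [X] using ⟨hb, hbt, htb⟩⟩
  have hDstep : ∀ w w', D w → G.Adj w w' → X w' → D w' := by
    rintro w w' ⟨p, hp⟩ h hX
    refine ⟨p.concat h, fun v hv => ?_⟩
    rw [Walk.support_concat, List.mem_append, List.mem_singleton] at hv
    rcases hv with hv | rfl
    · exact hp v hv
    · exact hX
  let S : V → Prop := fun s => s ∈ U ∧ G.Adj t s ∧ ∃ d, D d ∧ G.Adj s d
  have hS : ∀ s, S s → ∀ s', S s' → s ≠ s' → G.Adj s s' := by
    rintro s ⟨-, hs, d, ⟨p, hp⟩, hsd⟩ s' ⟨-, hs', d', ⟨p', hp'⟩, hsd'⟩ hne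
    refine hG.adj_of_adj_walk hs hs' hne hsd hsd' (p.reverse.append p') ?_
    intro v hv
    rw [Walk.mem_support_append_iff, Walk.support_reverse, List.mem_reverse] at hv
    rcases hv with hv | hv
    · exact (hp v hv).2
    · exact (hp' v hv).2
  let U' : Finset V := U.filter fun v => D v ∨ S v
  have hU'U : U' ⊂ U := by
    refine Finset.ssubset_iff_subset_ne.2 ⟨Finset.filter_subset _ _, fun h => ?_⟩
    have : t ∈ U' := h ▸ ht
    rcases (Finset.mem_filter.1 this).2 with h | h
    · exact (hDX t h).2.1 rfl
    · exact h.2.1.ne rfl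
  have hDU' : ∀ d, D d → d ∈ U' := fun d hd => Finset.mem_filter.2 ⟨(hDX d hd).1, Or.inl hd⟩
  have hSU' : ∀ s, S s → s ∈ U' := fun s hs => Finset.mem_filter.2 ⟨hs.1, Or.inr hs⟩
  have hnb : ∀ d, D d → ∀ a ∈ U, G.Adj d a → a ∈ U' := by
    intro d hd a ha hda
    by_cases hta : G.Adj t a
    · exact hSU' a ⟨ha, hta, d, hd, hda.symm⟩
    · refine hDU' a (hDstep d a hd hda ⟨ha, ?_, hta⟩)
      rintro rfl
      exact (hDX d hd).2.2 hda.symm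
  suffices h : ∃ v, D v ∧ G.IsSimplicialIn U' v by
    obtain ⟨v, hv, hv'⟩ := h
    exact ⟨v, ⟨(hDX v hv).1, fun a ha b hb hva hvb hab =>
      hv'.2 a (hnb v hv a ha hva) b (hnb v hv b hb hvb) hva hvb hab⟩, (hDX v hv).2⟩
  -- A non-neighbour of a vertex of the clique `S` lies in `D`. If there is none, `S` is joined to
  -- everything, and a non-neighbour of a vertex of `D` again lies in `D`.
  by_cases h1 : ∃ s, S s ∧ ∃ c ∈ U', c ≠ s ∧ ¬ G.Adj s c
  · obtain ⟨s, hs, c, hc, hcs, hsc⟩ := h1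
    obtain ⟨v, hv, hvs, hsv⟩ := ih U' hU'U s (hSU' s hs) c hc hcs hsc
    refine ⟨v, ?_, hv⟩
    rcases (Finset.mem_filter.1 hv.1).2 with h | h
    · exact h
    · exact absurd (hS s hs v h hvs.symm) hsv
  push Not at h1
  by_cases h2 : ∃ d, D d ∧ ∃ c ∈ U', c ≠ d ∧ ¬ G.Adj d c
  · obtain ⟨d, hd, c, hc, hcd, hdc⟩ := h2
    obtain ⟨v, hv, hvd, hdv⟩ := ih U' hU'U d (hDU' d hd) c hc hcd hdc
    refine ⟨v, ?_, hv⟩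
    rcases (Finset.mem_filter.1 hv.1).2 with h | h
    · exact h
    · exact absurd (h1 v h d (hDU' d hd) hvd.symm).symm hdv
  push Not at h2
  refine ⟨b, hbD, hDU' b hbD, fun x hx y hy _ _ hxy => ?_⟩
  rcases (Finset.mem_filter.1 hx).2 with h | h
  · exact h2 x h y hy hxy.symm
  · exact h1 x h y hy hxy.symm

/-! ### Interval models -/

/-- A chordal graph without three independent simplicial vertices has an interval model, in which
the closed neighbourhood of a given simplicial vertex is leftmost. -/
theorem IsChordal.exists_interval_model (hG : G.IsChordal) (U : Finset V) :
    ∀ x, G.IsSimplicialIn U x →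
      (∀ a b c, G.IsSimplicialIn U a → G.IsSimplicialIn U b → G.IsSimplicialIn U c →
        a ≠ b → b ≠ c → a ≠ c → G.Adj a b ∨ G.Adj b c ∨ G.Adj a c) →
      ∃ (l r : V → ℤ) (m : ℤ), (∀ v ∈ U, l v ≤ r v) ∧ (∀ v ∈ U, m ≤ l v) ∧
        (∀ v ∈ U, v = x ∨ G.Adj x v → l v = m) ∧
        ∀ u ∈ U, ∀ v ∈ U, u ≠ v → (G.Adj u v ↔ l u ≤ r v ∧ l v ≤ r u) := by
  classical
  induction U using Finset.strongInduction with
  | H U ih =>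
  intro x hx h3
  by_cases hc : ∀ a ∈ U, ∀ b ∈ U, a ≠ x → b ≠ x → a ≠ b → G.Adj a b
  · refine ⟨fun v => if v = x ∨ G.Adj x v then -1 else 0, fun v => if v = x then -1 else 0, -1,
      ?_, ?_, ?_, ?_⟩
    · intro v _; grind
    · intro v _; grind
    · intro v _ h; grind
    · intro u hu v hv huv
      have := hc u hu v hv
      have h1 := G.adj_comm u x
      have h2 := G.adj_comm v x
      grind
  push Not at hc
  obtain ⟨a, ha, b, hb, hax, hbx, hab, hnab⟩ := hc
  have hxU : x ∈ U := hx.1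
  have hmem : ∀ v, v ∈ U.erase x ↔ v ≠ x ∧ v ∈ U := fun v => Finset.mem_erase
  have hup : ∀ v, G.IsSimplicialIn (U.erase x) v → ¬ G.Adj x v → G.IsSimplicialIn U v := by
    intro v hv hxv
    refine ⟨((hmem v).1 hv.1).2, fun p hp q hq hvp hvq hpq => ?_⟩
    refine hv.2 p ?_ q ?_ hvp hvq hpq
    · exact (hmem p).2 ⟨fun h => hxv (h ▸ hvp.symm), hp⟩
    · exact (hmem q).2 ⟨fun h => hxv (h ▸ hvq.symm), hq⟩
  have hdirac := hG.exists_isSimplicialIn (U.erase x)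
  have hne : ∀ v, G.IsSimplicialIn (U.erase x) v → v ≠ x := fun v hv => ((hmem v).1 hv.1).1
  -- Otherwise two non-adjacent simplicial vertices of `U \ {x}` would remain simplicial in `U` and
  -- be independent of `x`.
  have hy : ∃ y, G.IsSimplicialIn (U.erase x) y ∧ G.Adj x y := by
    by_contra hno
    push Not at hno
    obtain ⟨v, hv, hva, hav⟩ := hdirac a ((hmem a).2 ⟨hax, ha⟩) b ((hmem b).2 ⟨hbx, hb⟩)
      hab.symm hnab
    obtain ⟨w, hw, hwv, hvw⟩ := hdirac v hv.1 a ((hmem a).2 ⟨hax, ha⟩) hva.symm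
      (fun h => hav h.symm)
    rcases h3 x v w hx (hup v hv (hno v hv)) (hup w hw (hno w hw)) (hne v hv).symm hwv.symm
      (hne w hw).symm with h | h | h
    · exact hno v hv h
    · exact hvw h
    · exact hno w hw h
  obtain ⟨y, hy, hxy⟩ := hy
  have h3' : ∀ a b c, G.IsSimplicialIn (U.erase x) a → G.IsSimplicialIn (U.erase x) b →
      G.IsSimplicialIn (U.erase x) c → a ≠ b → b ≠ c → a ≠ c →
      G.Adj a b ∨ G.Adj b c ∨ G.Adj a c := by
    intro a b c ha hb hc hab hbc hac
    -- Of two non-adjacent simplicial vertices exactly one is adjacent to `x`; this cannot hold for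
    -- all three pairs out of three vertices.
    have hpair : ∀ p q, G.IsSimplicialIn (U.erase x) p → G.IsSimplicialIn (U.erase x) q →
        p ≠ q → ¬ G.Adj p q → (G.Adj x p ∧ ¬ G.Adj x q) ∨ (G.Adj x q ∧ ¬ G.Adj x p) := by
      intro p q hp hq hpq hnpq
      by_cases hxp : G.Adj x p
      · by_cases hxq : G.Adj x q
        · exact absurd (hx.2 p ((hmem p).1 hp.1).2 q ((hmem q).1 hq.1).2 hxp hxq hpq) hnpq
        · exact Or.inl ⟨hxp, hxq⟩
      · by_cases hxq : G.Adj x q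
        · exact Or.inr ⟨hxq, hxp⟩
        · rcases h3 x p q hx (hup p hp hxp) (hup q hq hxq) (hne p hp).symm hpq
            (hne q hq).symm with h | h | h
          · exact absurd h hxp
          · exact absurd h hnpq
          · exact absurd h hxq
    by_contra hcon
    push Not at hcon
    have h1 := hpair a b ha hb hab hcon.1
    have h2 := hpair b c hb hc hbc hcon.2.1
    have h3 := hpair a c ha hc hac hcon.2.2
    tauto
  obtain ⟨l, r, m, hlr, hm, hlm, hadj⟩ := ih (U.erase x) (Finset.erase_ssubset hxU) y hy h3'
  -- The neighbours of `x` lie in the closed neighbourhood of `y`, so all of them start at `m` and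
  -- can be prolonged to `m - 1`, the place of the one-point interval of `x`.
  have hNy : ∀ v ∈ U, G.Adj x v → l v = m := by
    intro v hv hxv
    refine hlm v ((hmem v).2 ⟨hxv.ne', hv⟩) ?_
    by_cases hvy : v = y
    · exact Or.inl hvy
    · exact Or.inr (hx.2 y ((hmem y).1 hy.1).2 v hv hxy hxv (Ne.symm hvy))
  refine ⟨fun v => if v = x ∨ G.Adj x v then m - 1 else l v,
    fun v => if v = x then m - 1 else r v, m - 1, ?_, ?_, ?_, ?_⟩
  · intro v hv
    have h1 := hlr v
    have h2 := hm v
    rw [hmem] at h1 h2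
    grind
  · intro v hv
    have h2 := hm v
    rw [hmem] at h2
    grind
  · intro v hv h
    exact if_pos h
  · intro u hu v hv huv
    have h1 := hlr u
    have h2 := hm u
    have h3 := hlr v
    have h4 := hm v
    have h5 := hadj u
    have h6 := hNy u hu
    have h7 := hNy v hv
    have h8 := G.adj_comm u x
    have h9 := G.adj_comm v x
    rw [hmem] at h1 h2 h3 h4 h5
    by_cases hux : u = x
    · subst hux
      by_cases huv' : G.Adj u v <;> grind
    by_cases hvx : v = x
    · subst hvx
      by_cases huv' : G.Adj u v <;> grind
    have h5' := h5 ⟨hux, hu⟩ v ((hmem v).2 ⟨hvx, hv⟩) huv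
    have h1' := h1 ⟨hux, hu⟩
    have h2' := h2 ⟨hux, hu⟩
    have h3' := h3 ⟨hvx, hv⟩
    have h4' := h4 ⟨hvx, hv⟩
    rw [h5']
    simp only [hux, hvx, false_or, if_false]
    split_ifs with ha hb hb
    · have := h6 ha; have := h7 hb; omega
    · have := h6 ha; omega
    · have := h7 hb; omega
    · rfl

/-- Scaling moves all intervals into `[-1, 1]`, where `Circle.exp` is injective. Adding `1 / 2` to
the right ends gives one-point intervals a positive length and, the ends being integers, creates no
new intersection. -/
theorem isCircularArc_of_interval_model [Finite V] (l r : V → ℤ) (hlr : ∀ v, l v ≤ r v)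
    (hadj : ∀ u v, u ≠ v → (G.Adj u v ↔ l u ≤ r v ∧ l v ≤ r u)) : G.IsCircularArc := by
  have hbd : ∃ M : ℝ, 0 < M ∧ ∀ v, |(l v : ℝ)| + |(r v : ℝ)| ≤ M := by
    obtain ⟨M, hM⟩ := (Set.finite_range fun v => |(l v : ℝ)| + |(r v : ℝ)|).bddAbove
    exact ⟨max M 1, by positivity, fun v => (hM ⟨v, rfl⟩).trans (le_max_left _ _)⟩
  obtain ⟨M, hM0, hM⟩ := hbd
  have hl : ∀ v, -M ≤ l v ∧ (r v : ℝ) ≤ M := fun v =>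
    ⟨by linarith [hM v, neg_abs_le (l v : ℝ), abs_nonneg (r v : ℝ)],
      by linarith [hM v, le_abs_self (r v : ℝ), abs_nonneg (l v : ℝ)]⟩
  set c : ℝ := 1 / (M + 1) with hc
  have hc0 : 0 < c := by positivity
  have hcM : c * (M + 1) = 1 := by rw [hc]; field_simp
  have hpi := Real.pi_gt_three
  have hrange : ∀ v, -1 ≤ c * l v ∧ c * (r v + 1 / 2) ≤ 1 := fun v =>
    ⟨by nlinarith [(hl v).1], by nlinarith [(hl v).2]⟩
  have hlr' : ∀ v, (l v : ℝ) ≤ r v := fun v => by exact_mod_cast hlr v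
  refine ⟨fun v => Circle.exp '' Set.Icc (c * l v) (c * (r v + 1 / 2)), fun v =>
    ⟨_, _, ?_, ?_, rfl⟩, ?_⟩
  · nlinarith [hlr' v]
  · linarith [hrange v]
  · intro u v huv
    have hle : ∀ p q : V, c * l p ≤ c * (r q + 1 / 2) ↔ l p ≤ r q := by
      intro p q
      rw [mul_le_mul_iff_right₀ hc0]
      constructor
      · intro h
        have : (l p : ℝ) < (r q : ℝ) + 1 := by linarith
        have : l p < r q + 1 := by exact_mod_cast this
        omega
      · intro h
        have : (l p : ℝ) ≤ r q := by exact_mod_cast h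
        linarith
    rw [hadj u v huv]
    constructor
    · rintro ⟨h1, h2⟩
      have h3 := (hle u v).2 h1
      have h4 := (hle v u).2 h2
      have h5 := (hle u u).2 (hlr u)
      have h6 := (hle v v).2 (hlr v)
      exact ⟨Circle.exp (max (c * l u) (c * l v)),
        ⟨_, ⟨le_max_left _ _, max_le h5 h4⟩, rfl⟩, ⟨_, ⟨le_max_right _ _, max_le h3 h6⟩, rfl⟩⟩
    · rintro ⟨z, ⟨s, hs, rfl⟩, ⟨t, ht, hst⟩⟩
      have hst' : t = s := Circle.exp_injOn_Icc (a := -1) (b := 1) (by linarith)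
        ⟨(hrange v).1.trans ht.1, ht.2.trans (hrange v).2⟩
        ⟨(hrange u).1.trans hs.1, hs.2.trans (hrange u).2⟩ hst
      subst hst'
      exact ⟨(hle u v).1 (hs.1.trans ht.2), (hle v u).1 (ht.1.trans hs.2)⟩

/-! ### Arcs from four cliques in circular order -/

/-- The edges between two disjoint cliques of a chordal graph are determined by comparing weights
of their vertices. -/
theorem IsChordal.exists_threshold [Finite V] (hG : G.IsChordal) {E S : Set V} (hE : G.IsClique E)
    (hS : G.IsClique S) (hES : Disjoint E S) :
    ∃ e s : V → ℝ, (∀ v, 0 < e v ∧ e v < 1) ∧ (∀ v, 0 < s v ∧ s v < 1) ∧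
      ∀ v ∈ E, ∀ w ∈ S, (G.Adj v w ↔ s w ≤ e v) := by
  classical
  have := Fintype.ofFinite V
  -- By chordality the sets `N v` are nested. `D w` is the intersection of those containing `w`,
  -- within `S`, so `v` and `w` are adjacent exactly if `D w ⊆ N v`, and cardinalities decide this.
  let N : V → Finset V := fun v => Finset.univ.filter fun w => w ∈ S ∧ G.Adj v w
  let D : V → Finset V := fun w => Finset.univ.filter fun w' =>
    w' ∈ S ∧ ∀ v ∈ E, G.Adj v w → G.Adj v w'
  have hN : ∀ v w, w ∈ N v ↔ w ∈ S ∧ G.Adj v w := fun v w => by simp [N]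
  have hD : ∀ w w', w' ∈ D w ↔ w' ∈ S ∧ ∀ v ∈ E, G.Adj v w → G.Adj v w' := fun v w => by simp [D]
  have hchain : ∀ v ∈ E, ∀ v' ∈ E, ∀ w ∈ N v, w ∉ N v' → N v' ⊆ N v := by
    intro v hv v' hv' w hw hw' w' hww'
    by_contra hnw
    rw [hN] at hw hw' hww' hnw
    have hvw' : ¬ G.Adj v w' := fun h => hnw ⟨hww'.1, h⟩
    have hv'w : ¬ G.Adj v' w := fun h => hw' ⟨hw.1, h⟩
    have hvv' : v ≠ v' := by rintro rfl; exact hv'w hw.2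
    have hne : w ≠ w' := by rintro rfl; exact hvw' hw.2
    exact hv'w (hG.adj_of_four_cycle hw.2 (hS hw.1 hww'.1 hne) hww'.2.symm (hE hv' hv hvv'.symm)
      (fun h => hES.le_bot ⟨hv, h ▸ hww'.1⟩) (fun h => hES.le_bot ⟨hv', h ▸ hw.1⟩) hvw').symm
  have hkey : ∀ v ∈ E, ∀ w ∈ S, (G.Adj v w ↔ (D w).card ≤ (N v).card) := by
    intro v hv w hw
    constructor
    · intro h
      refine Finset.card_le_card fun w' hw' => ?_
      rw [hD] at hw'
      exact (hN _ _).2 ⟨hw'.1, hw'.2 v hv h⟩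
    · intro h
      by_contra hvw
      refine absurd h (not_le.2 (Finset.card_lt_card ?_))
      refine (Finset.ssubset_iff_of_subset fun w'' hw'' => ?_).2
        ⟨w, (hD _ _).2 ⟨hw, fun _ _ h => h⟩, fun h => hvw ((hN _ _).1 h).2⟩
      refine (hD _ _).2 ⟨((hN _ _).1 hw'').1, fun v' hv' hvw' => ?_⟩
      exact ((hN _ _).1 (hchain v' hv' v hv w ((hN _ _).2 ⟨hw, hvw'⟩)
        (fun h => hvw ((hN _ _).1 h).2) hw'')).2
  set n : ℝ := (Fintype.card V : ℝ) with hn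
  have hn0 : 0 < n + 2 := by positivity
  have hcard : ∀ A : Finset V, (A.card : ℝ) ≤ n := fun A => by
    rw [hn]; exact_mod_cast Finset.card_le_univ A
  have hunit : ∀ A : Finset V, 0 < ((A.card : ℝ) + 1) / (n + 2) ∧
      ((A.card : ℝ) + 1) / (n + 2) < 1 := fun A =>
    ⟨by positivity, by rw [div_lt_one hn0]; linarith [hcard A]⟩
  refine ⟨fun v => ((N v).card + 1) / (n + 2), fun w => ((D w).card + 1) / (n + 2),
    fun v => hunit _, fun v => hunit _, fun v hv w hw => ?_⟩
  rw [hkey v hv w hw, div_le_div_iff_of_pos_right hn0, add_le_add_iff_right, Nat.cast_le]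

/-- The part of an arc in the `i`-th quarter of the circle, for an arc that contains the corners
in `F`, extends in the `i`-th quarter up to `e i` behind the corner `i`, and begins
in this quarter at `s i` in front of the corner `i + 1`. -/
def quarterMem (F : ZMod 4 → Prop) (e s : ZMod 4 → ℝ) (i : ZMod 4) (x : ℝ) : Prop :=
  (F i ∧ F (i + 1)) ∨ (F i ∧ x ≤ e i) ∨ (F (i + 1) ∧ s i ≤ x)

/-- The arc begins in the quarter before its first corner and ends in the quarter after its last
one. For `k ≤ 2` these quarters differ, so the arc is shorter than a full turn. -/
theorem isCircleArc_of_quarters {F : ZMod 4 → Prop} {e s : ZMod 4 → ℝ}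
    (he : ∀ i, 0 < e i ∧ e i < 1) (hs : ∀ i, 0 < s i ∧ s i < 1)
    (hF : ∃ (a : ZMod 4) (k : ℕ), k ≤ 2 ∧ ∀ i, F i ↔ ∃ j : ℕ, j ≤ k ∧ i = a + j) :
    IsCircleArc {z | ∃ (n : ℤ) (x : ℝ), 0 ≤ x ∧ x < 1 ∧ quarterMem F e s n x ∧
      z = Circle.exp (Real.pi / 2 * (n + x))} := by
  obtain ⟨a, k, hk, hF⟩ := hF
  obtain ⟨c, rfl⟩ := ZMod.intCast_surjective a
  have hpi := Real.pi_pos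
  have hk' : (k : ℝ) ≤ 2 := by exact_mod_cast hk
  have hs1 := hs (c - 1)
  have he1 := he (c + k)
  refine ⟨Real.pi / 2 * (c - 1 + s (c - 1)), Real.pi / 2 * (c + k + e (c + k)), ?_, ?_, ?_⟩
  · have : (0 : ℝ) ≤ k := by positivity
    exact mul_lt_mul_of_pos_left (by linarith) (by positivity)
  · nlinarith
  ext z
  constructor
  · rintro ⟨n, x, hx0, hx1, hM, rfl⟩
    suffices h : ∃ n' : ℤ, (n' : ZMod 4) = n ∧ c - 1 + s (c - 1) ≤ n' + x ∧
        n' + x ≤ c + k + e (c + k) by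
      obtain ⟨n', hn', h1, h2⟩ := h
      refine ⟨Real.pi / 2 * (n' + x), ⟨by gcongr, by gcongr⟩, ?_⟩
      obtain ⟨q, hq⟩ := (ZMod.intCast_eq_intCast_iff_dvd_sub _ _ 4).1 hn'
      rw [Circle.exp_eq_exp]
      refine ⟨-q, ?_⟩
      have : (n : ℝ) = n' + 4 * q := by
        have : n = n' + 4 * q := by push_cast at hq; linarith
        exact_mod_cast this
      rw [this]; push_cast; ring
    have hcase : (∃ j : ℕ, j < k ∧ (n : ZMod 4) = c + j) ∨ ((n : ZMod 4) = c + k ∧ x ≤ e n) ∨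
        ((n : ZMod 4) = c - 1 ∧ s n ≤ x) := by
      rcases hM with ⟨h1, h2⟩ | ⟨h1, h2⟩ | ⟨h1, h2⟩
      · obtain ⟨j, hj, hnj⟩ := (hF _).1 h1
        obtain ⟨j', hj', hnj'⟩ := (hF _).1 h2
        refine Or.inl ⟨j, ?_, hnj⟩
        have hjj : (((j : ℤ) + 1 : ℤ) : ZMod 4) = ((j' : ℤ) : ZMod 4) := by
          rw [hnj] at hnj'
          push_cast
          linear_combination hnj'
        obtain ⟨q, hq⟩ := (ZMod.intCast_eq_intCast_iff_dvd_sub _ _ 4).1 hjj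
        push_cast at hq
        omega
      · obtain ⟨j, hj, hnj⟩ := (hF _).1 h1
        rcases hj.lt_or_eq with hj | rfl
        · exact Or.inl ⟨j, hj, hnj⟩
        · exact Or.inr (Or.inl ⟨hnj, h2⟩)
      · obtain ⟨j, hj, hnj⟩ := (hF _).1 h1
        rcases j with _ | j
        · exact Or.inr (Or.inr ⟨by push_cast at hnj; linear_combination hnj, h2⟩)
        · exact Or.inl ⟨j, hj, by push_cast at hnj; linear_combination hnj⟩
    rcases hcase with ⟨j, hj, hnj⟩ | ⟨hn, hx⟩ | ⟨hn, hx⟩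
    · have hj' : (j : ℝ) + 1 ≤ k := by exact_mod_cast hj
      have hj0 : (0 : ℝ) ≤ j := by positivity
      refine ⟨c + j, by rw [hnj]; push_cast; rfl, ?_, ?_⟩ <;> push_cast <;> linarith
    · rw [hn] at hx
      have : (0 : ℝ) ≤ k := by positivity
      refine ⟨c + k, by rw [hn]; push_cast; rfl, ?_, ?_⟩ <;> push_cast <;> linarith
    · rw [hn] at hx
      have : (0 : ℝ) ≤ k := by positivity
      refine ⟨c - 1, by rw [hn]; push_cast; rfl, ?_, ?_⟩ <;> push_cast <;> linarith
  · rintro ⟨t, ⟨ht1, ht2⟩, rfl⟩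
    obtain ⟨y, rfl⟩ : ∃ y, t = Real.pi / 2 * y := ⟨t / (Real.pi / 2), by field_simp⟩
    have hpi2 : 0 < Real.pi / 2 := by positivity
    have h1 := le_of_mul_le_mul_left ht1 hpi2
    have h2 := le_of_mul_le_mul_left ht2 hpi2
    refine ⟨⌊y⌋, Int.fract y, Int.fract_nonneg y, Int.fract_lt_one y, ?_, by
      rw [Int.floor_add_fract]⟩
    have hlow : c - 1 ≤ ⌊y⌋ := by
      rw [Int.le_floor]; push_cast; linarith
    have hup : ⌊y⌋ < c + k + 1 := by
      rw [Int.floor_lt]; push_cast; linarith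
    have hy := Int.floor_add_fract y
    obtain ⟨m, hm⟩ : ∃ m : ℕ, ⌊y⌋ = c - 1 + m := ⟨(⌊y⌋ - (c - 1)).toNat, by omega⟩
    have hmk : m ≤ k + 1 := by omega
    rw [hm] at hy
    rw [hm]
    rcases m with _ | m
    · refine Or.inr (Or.inr ⟨(hF _).2 ⟨0, by omega, by push_cast; ring⟩, ?_⟩)
      push_cast at hy ⊢
      rw [add_zero]
      linarith
    · by_cases hmk' : m = k
      · subst hmk'
        refine Or.inr (Or.inl ⟨(hF _).2 ⟨m, le_rfl, by push_cast; ring⟩, ?_⟩)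
        have : ((c - 1 + (m + 1 : ℕ) : ℤ) : ZMod 4) = c + m := by push_cast; ring
        rw [this]
        push_cast at hy
        linarith
      · exact Or.inl ⟨(hF _).2 ⟨m, by omega, by push_cast; ring⟩,
          (hF _).2 ⟨m + 1, by omega, by push_cast; ring⟩⟩

/-- A chordal graph covered by four cliques in a circular order, such that the cliques of a vertex
are consecutive and adjacent vertices lie in equal or consecutive cliques, is a circular-arc
graph. -/
theorem IsChordal.isCircularArc_of_cyclic_cover [Finite V] (hG : G.IsChordal)
    (F : V → ZMod 4 → Prop)
    (hF : ∀ v, ∃ (a : ZMod 4) (k : ℕ), k ≤ 2 ∧ ∀ i, F v i ↔ ∃ j : ℕ, j ≤ k ∧ i = a + j)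
    (hclique : ∀ i u v, F u i → F v i → u ≠ v → G.Adj u v)
    (hadj : ∀ u v, G.Adj u v → ∃ i, (F u i ∧ F v i) ∨ (F u i ∧ F v (i + 1)) ∨
      (F v i ∧ F u (i + 1))) : G.IsCircularArc := by
  have hth := fun i => hG.exists_threshold
    (E := {v | F v i ∧ ¬ F v (i + 1)}) (S := {v | F v (i + 1) ∧ ¬ F v i})
    (fun u hu v hv h => hclique i u v hu.1 hv.1 h)
    (fun u hu v hv h => hclique (i + 1) u v hu.1 hv.1 h)
    (Set.disjoint_left.2 fun v hv hv' => hv'.2 hv.1)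
  choose e s he hs hes using hth
  refine ⟨fun v => {z | ∃ (n : ℤ) (x : ℝ), 0 ≤ x ∧ x < 1 ∧
    quarterMem (F v) (fun i => e i v) (fun i => s i v) n x ∧
      z = Circle.exp (Real.pi / 2 * (n + x))},
    fun v => isCircleArc_of_quarters (fun i => he i v) (fun i => hs i v) (hF v), ?_⟩
  intro u v huv
  constructor
  · intro h
    by_cases hsh : ∃ i, F u i ∧ F v i
    · obtain ⟨i, hu, hv⟩ := hsh
      obtain ⟨n, rfl⟩ := ZMod.intCast_surjective i
      exact ⟨_, ⟨n, 0, le_rfl, one_pos, Or.inr (Or.inl ⟨hu, (he _ _).1.le⟩), rfl⟩,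
        ⟨n, 0, le_rfl, one_pos, Or.inr (Or.inl ⟨hv, (he _ _).1.le⟩), rfl⟩⟩
    · push Not at hsh
      have key : ∀ p q, G.Adj p q → (∀ i, F p i → ¬ F q i) → ∀ n : ℤ, F p n → F q (n + 1) →
          ∃ x : ℝ, 0 ≤ x ∧ x < 1 ∧
            quarterMem (F p) (fun i => e i p) (fun i => s i p) n x ∧
            quarterMem (F q) (fun i => e i q) (fun i => s i q) n x := by
        intro p q hpq hd n hp hq
        -- The last point of the arc of `p` in this quarter.
        refine ⟨e n p, (he _ _).1.le, (he _ _).2, Or.inr (Or.inl ⟨hp, le_rfl⟩),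
          Or.inr (Or.inr ⟨hq, ?_⟩)⟩
        exact (hes n p ⟨hp, fun h => hd _ h hq⟩ q ⟨hq, hd _ hp⟩).1 hpq
      obtain ⟨i, hi⟩ := hadj u v h
      obtain ⟨n, rfl⟩ := ZMod.intCast_surjective i
      rcases hi with hi | hi | hi
      · exact absurd hi.2 (hsh _ hi.1)
      · obtain ⟨x, h0, h1, h2, h3⟩ := key u v h hsh n hi.1 hi.2
        exact ⟨_, ⟨n, x, h0, h1, h2, rfl⟩, ⟨n, x, h0, h1, h3, rfl⟩⟩
      · obtain ⟨x, h0, h1, h2, h3⟩ := key v u h.symm (fun i h h' => hsh i h' h) n hi.1 hi.2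
        exact ⟨_, ⟨n, x, h0, h1, h3, rfl⟩, ⟨n, x, h0, h1, h2, rfl⟩⟩
  · rintro ⟨z, ⟨n, x, hx0, hx1, hM, rfl⟩, ⟨n', x', hx0', hx1', hM', hz⟩⟩
    obtain ⟨m, hm⟩ := Circle.exp_eq_exp.1 hz
    have hpi2 : Real.pi / 2 ≠ 0 := by positivity
    have hm' : (n : ℝ) + x = n' + x' + 4 * m := by
      apply mul_left_cancel₀ hpi2
      rw [hm]; ring
    have hnn : n = n' + 4 * m := by
      have h1 : ⌊(n : ℝ) + x⌋ = n := by
        rw [Int.floor_intCast_add, Int.floor_eq_zero_iff.2 ⟨hx0, hx1⟩, add_zero]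
      have h2 : ⌊(n' : ℝ) + x' + 4 * m⌋ = n' + 4 * m := by
        have : (n' : ℝ) + x' + 4 * m = ((n' + 4 * m : ℤ) : ℝ) + x' := by push_cast; ring
        rw [this, Int.floor_intCast_add, Int.floor_eq_zero_iff.2 ⟨hx0', hx1'⟩, add_zero]
      rw [← h1, hm', h2]
    have hxx : x = x' := by
      have : (n : ℝ) = n' + 4 * m := by exact_mod_cast hnn
      linarith
    have hnz : (n' : ZMod 4) = n := by
      rw [hnn]; push_cast
      have : (4 : ZMod 4) = 0 := rfl
      rw [this]; ring
    rw [hnz, ← hxx] at hM'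
    generalize (n : ZMod 4) = i at hM hM'
    by_contra hnadj
    have hd : ∀ i, F u i → ¬ F v i := fun i h h' => hnadj (hclique i u v h h' huv)
    have key : ∀ p q, ¬ G.Adj p q → (∀ i, F p i → ¬ F q i) → F p i → x ≤ e i p → F q (i + 1) →
        s i q ≤ x → False := by
      intro p q hpq hd hp hx hq hx'
      exact hpq ((hes i p ⟨hp, fun h => hd _ h hq⟩ q ⟨hq, hd _ hp⟩).2 (hx'.trans hx))
    have hd0 := hd i
    have hd1 := hd (i + 1)
    rcases hM with ⟨h1, h2⟩ | ⟨h1, h2⟩ | ⟨h1, h2⟩ <;>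
      rcases hM' with ⟨h3, h4⟩ | ⟨h3, h4⟩ | ⟨h3, h4⟩ <;> try tauto
    · exact key u v hnadj hd h1 h2 h3 h4
    · exact key v u (fun h => hnadj h.symm) (fun i h h' => hd i h' h) h3 h4 h1 h2

/-! ### Circular-arc graphs have no blocking quadruple -/

theorem IsCircleArc.isPreconnected {S : Set Circle} (h : IsCircleArc S) : IsPreconnected S := by
  obtain ⟨a, b, -, -, rfl⟩ := h
  exact isPreconnected_Icc.image _ Circle.exp.continuous.continuousOn

theorem IsCircleArc.nonempty {S : Set Circle} (h : IsCircleArc S) : S.Nonempty := by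
  obtain ⟨a, b, hab, -, rfl⟩ := h
  exact (Set.nonempty_Icc.2 hab.le).image _

/-- A connected subset of the circle that contains two points separated by `exp (i p)`
and `exp (i q)` contains one of these. -/
theorem not_separated_of_isPreconnected {S : Set Circle} (hS : IsPreconnected S) {a b p q : ℝ}
    (ha : Circle.exp a ∈ S) (hb : Circle.exp b ∈ S) (hp : Circle.exp p ∉ S)
    (hq : Circle.exp q ∉ S) :
    ¬ (Real.sin ((a - p) / 2) * Real.sin ((a - q) / 2)) *
      (Real.sin ((b - p) / 2) * Real.sin ((b - q) / 2)) < 0 := by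
  intro hneg
  -- An affine function of the plane that vanishes on the line through `exp (i p)` and `exp (i q)`;
  -- its sign tells the two sides apart.
  let g : Circle → ℝ := fun z => Real.cos ((p - q) / 2) -
    ((z : ℂ).re * Real.cos ((p + q) / 2) + (z : ℂ).im * Real.sin ((p + q) / 2))
  have hg : Continuous g := by
    have h1 : Continuous fun z : Circle => (z : ℂ).re := Complex.continuous_re.comp
      continuous_subtype_val
    have h2 : Continuous fun z : Circle => (z : ℂ).im := Complex.continuous_im.comp
      continuous_subtype_val
    fun_prop
  have hgt : ∀ t : ℝ, g (Circle.exp t) =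
      2 * (Real.sin ((t - p) / 2) * Real.sin ((t - q) / 2)) := by
    intro t
    have h1 : ((Circle.exp t : Circle) : ℂ).re = Real.cos t := by
      rw [Circle.coe_exp, Complex.exp_ofReal_mul_I_re]
    have h2 : ((Circle.exp t : Circle) : ℂ).im = Real.sin t := by
      rw [Circle.coe_exp, Complex.exp_ofReal_mul_I_im]
    simp only [g, h1, h2]
    rw [← Real.cos_sub, Real.cos_sub_cos]
    have e1 : ((p - q) / 2 + (t - (p + q) / 2)) / 2 = (t - q) / 2 := by ring
    have e2 : ((p - q) / 2 - (t - (p + q) / 2)) / 2 = -((t - p) / 2) := by ring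
    rw [e1, e2, Real.sin_neg]
    ring
  have hzero : ∀ z ∈ S, g z ≠ 0 := by
    intro z hz h0
    obtain ⟨t, rfl⟩ := Circle.exp_surjective z
    have haux : ∀ r : ℝ, Real.sin ((t - r) / 2) = 0 → Circle.exp t = Circle.exp r := by
      intro r hr
      obtain ⟨n, hn⟩ := Real.sin_eq_zero_iff.1 hr
      exact Circle.exp_eq_exp.2 ⟨n, by linarith⟩
    rw [hgt] at h0
    rcases mul_eq_zero.1 (by linarith :
      Real.sin ((t - p) / 2) * Real.sin ((t - q) / 2) = 0) with h | h
    · exact hp (haux p h ▸ hz)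
    · exact hq (haux q h ▸ hz)
  have hcon := hS.image g hg.continuousOn
  have hmem : ∀ x y, x ∈ g '' S → y ∈ g '' S → x < 0 → 0 < y → False := by
    intro x y hx hy hx0 hy0
    obtain ⟨z, hz, h0⟩ := hcon.Icc_subset hx hy ⟨hx0.le, hy0.le⟩
    exact hzero z hz h0
  have hA := Set.mem_image_of_mem g ha
  have hB := Set.mem_image_of_mem g hb
  rw [hgt] at hA hB
  rcases mul_neg_iff.1 hneg with ⟨h1, h2⟩ | ⟨h1, h2⟩
  · exact hmem _ _ hB hA (by linarith) (by linarith)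
  · exact hmem _ _ hA hB (by linarith) (by linarith)

/-- Hence a vertex that misses a walk cannot lie on it, except as its start. -/
theorem Walk.exists_adj_of_mem_support {x y z : V} (p : G.Walk x y) (hz : z ∈ p.support)
    (hxz : z ≠ x) : ∃ u ∈ p.support, G.Adj z u := by
  induction p with
  | nil => exact absurd (by simpa using hz) hxz
  | @cons a b c h p ih =>
    rw [Walk.support_cons, List.mem_cons] at hz
    rcases hz with hz | hz
    · exact absurd hz hxz
    · by_cases hb : z = b
      · exact ⟨a, by simp, hb ▸ h.symm⟩
      · obtain ⟨u, hu, h⟩ := ih hz hb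
        exact ⟨u, by simp [hu], h⟩

theorem Walk.isPreconnected_iUnion {A : V → Set Circle} (hA : ∀ v, IsCircleArc (A v))
    (hadj : ∀ u v, G.Adj u v → (A u ∩ A v).Nonempty) {x y : V} (p : G.Walk x y) :
    IsPreconnected (⋃ u ∈ p.support, A u) := by
  induction p with
  | nil => simpa using (hA _).isPreconnected
  | @cons a b c h p ih =>
    obtain ⟨z, hz⟩ := hadj a b h
    have : (⋃ u ∈ (Walk.cons h p).support, A u) = A a ∪ ⋃ u ∈ p.support, A u := by
      ext w; simp
    rw [this]
    exact IsPreconnected.union z hz.1 (Set.mem_biUnion p.start_mem_support hz.2)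
      (hA a).isPreconnected ih

theorem Avoid.not_adj {x y z w : V} (h : G.Avoid x y z w) :
    ¬ G.Adj x z ∧ ¬ G.Adj x w ∧ ¬ G.Adj y z ∧ ¬ G.Adj y w := by
  rcases h with ⟨p, -, hz, hw⟩ | ⟨p, -, hx, hy⟩
  · exact ⟨fun h => hz _ p.start_mem_support h.symm, fun h => hw _ p.start_mem_support h.symm,
      fun h => hz _ p.end_mem_support h.symm, fun h => hw _ p.end_mem_support h.symm⟩
  · exact ⟨hx _ p.start_mem_support, hx _ p.end_mem_support, hy _ p.start_mem_support,
      hy _ p.end_mem_support⟩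

theorem IsCircularArc.not_isBlockingQuadruple (hG : G.IsCircularArc) {x y z w : V} :
    ¬ G.IsBlockingQuadruple x y z w := by
  rintro ⟨⟨hxy, hxz, hxw, hyz, hyw, hzw⟩, h1, h2, h3⟩
  obtain ⟨A, hA, hadj⟩ := hG
  have hpt : ∀ v, ∃ t : ℝ, Circle.exp t ∈ A v := fun v => by
    obtain ⟨c, hc⟩ := (hA v).nonempty
    obtain ⟨t, rfl⟩ := Circle.exp_surjective c
    exact ⟨t, hc⟩
  choose θ hθ using hpt
  have hconn := fun {x y : V} (p : G.Walk x y) => p.isPreconnected_iUnion hA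
    fun u v h => (hadj u v h.ne).1 h
  have hmiss : ∀ {x y z : V} (p : G.Walk x y), z ≠ x → G.Misses z p →
      Circle.exp (θ z) ∉ ⋃ u ∈ p.support, A u := by
    intro x y z p hzx hz hmem
    simp only [Set.mem_iUnion, exists_prop] at hmem
    obtain ⟨u, hu, hzu⟩ := hmem
    by_cases h : z = u
    · subst h
      obtain ⟨u', hu', h⟩ := p.exists_adj_of_mem_support hu hzx
      exact hz u' hu' h
    · exact hz u hu ((hadj z u h).2 ⟨_, hθ z, hzu⟩)
  let σ : V → V → ℝ := fun u v => Real.sin ((θ u - θ v) / 2)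
  have hσ : ∀ u v, σ u v = - σ v u := by
    intro u v
    simp only [σ]
    rw [← Real.sin_neg]
    congr 1
    ring
  have havoid : ∀ {x y z w : V}, x ≠ z → x ≠ w → G.Avoid x y z w → y ≠ z →
      0 ≤ (σ x z * σ x w) * (σ y z * σ y w) := by
    intro x y z w hxz hxw h hyz
    rcases h with ⟨p, -, hz, hw⟩ | ⟨p, -, hx, hy⟩
    · exact not_lt.1 (not_separated_of_isPreconnected (hconn p)
        (Set.mem_biUnion p.start_mem_support (hθ x)) (Set.mem_biUnion p.end_mem_support (hθ y))
        (hmiss p hxz.symm hz) (hmiss p hxw.symm hw))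
    · have := not_lt.1 (not_separated_of_isPreconnected (hconn p)
        (Set.mem_biUnion p.start_mem_support (hθ z)) (Set.mem_biUnion p.end_mem_support (hθ w))
        (hmiss p hxz hx) (hmiss p hyz hy))
      change 0 ≤ (σ z x * σ z y) * (σ w x * σ w y) at this
      rw [hσ z x, hσ z y, hσ w x, hσ w y] at this
      linarith
  have hne : ∀ u v, u ≠ v → ¬ G.Adj u v → σ u v ≠ 0 := by
    intro u v huv hn h0
    refine hn ((hadj u v huv).2 ⟨Circle.exp (θ u), hθ u, ?_⟩)
    obtain ⟨n, hn⟩ := Real.sin_eq_zero_iff.1 h0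
    rw [Circle.exp_eq_exp.2 ⟨n, by linarith⟩]
    exact hθ v
  have p1 := havoid hxz hxw h1 hyz
  have p2 := havoid hxy hxw h2 hyz.symm
  have p3 := havoid hxy hxz h3 hyw.symm
  have n1 := h1.not_adj
  have n2 := h2.not_adj
  have q1 := hne x y hxy n2.1
  have q2 := hne x z hxz n1.1
  have q3 := hne x w hxw n1.2.1
  have q4 := hne y z hyz n1.2.2.1
  have q5 := hne y w hyw n1.2.2.2
  have q6 := hne z w hzw n2.2.2.2
  rw [hσ z y] at p2
  rw [hσ w y, hσ w z] at p3
  -- Each of the six factors `σ` occurs twice in this product, and the sign changes leave minus a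
  -- nonzero square.
  have hprod := mul_nonneg (mul_nonneg p1 p2) p3
  have hpos : 0 < (σ x y * σ x z * σ x w * σ y z * σ y w * σ z w) ^ 2 := by positivity
  nlinarith

/-! ### Enlarging `R` to the fourth clique -/

/-- The cyclically consecutive sets of at most three corners of a square. -/
theorem exists_cyclic_interval : ∀ f : ZMod 4 → Bool, (∃ i, f i = true) →
    ¬ (f 0 = true ∧ f 2 = true) → ¬ (f 0 = false ∧ f 1 = true ∧ f 2 = false ∧ f 3 = true) →
    ∃ (a : ZMod 4) (k : Fin 3), ∀ i, f i = true ↔ ∃ j : Fin 3, j ≤ k ∧ i = a + (j.val : ZMod 4) := by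
  decide

/-- A chordal graph covered by three cliques `Q₁, Q₂, Q₃` and a clique `R` disjoint from them is a
circular-arc graph, if every connection of `Q₂` and `Q₃` outside `Q₁` hits all of `R`, and `Q₁`
is joined to `R` through `Q₂ ∪ Q₃` only. -/
theorem IsChordal.isCircularArc_of_three_cliques [Finite V] (hG : G.IsChordal)
    {Q₁ Q₂ Q₃ R : Set V} (hQ₁ : G.IsClique Q₁) (hQ₂ : G.IsClique Q₂) (hQ₃ : G.IsClique Q₃)
    (hR : G.IsClique R) (hcov : ∀ v, v ∈ R ↔ v ∉ Q₁ ∧ v ∉ Q₂ ∧ v ∉ Q₃)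
    (h₂₃ : ∀ u ∈ Q₂, ∀ v ∈ Q₃, u ∉ Q₁ → v ∉ Q₁ → (u = v ∨ G.Adj u v) →
      ∀ r ∈ R, G.Adj u r ∨ G.Adj v r)
    (h₁ : ∀ u ∈ Q₁, u ∉ Q₂ → u ∉ Q₃ → ∀ r ∈ R, ¬ G.Adj u r) : G.IsCircularArc := by
  classical
  let C : V → Prop := fun v => v ∉ Q₁ ∧ ∀ r ∈ R, G.Adj v r
  have hcomp : ∀ u ∈ Q₂, ∀ v ∈ Q₃, u ∉ Q₁ → v ∉ Q₁ → G.Adj u v → C u ∨ C v := by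
    intro u hu v hv hu1 hv1 huv
    by_contra hcon
    simp only [C, not_or, not_and, not_forall] at hcon
    obtain ⟨r, hr, hur⟩ := hcon.1 hu1
    obtain ⟨r', hr', hvr'⟩ := hcon.2 hv1
    have hvr := (h₂₃ u hu v hv hu1 hv1 (Or.inr huv) r hr).resolve_left hur
    have hur' := (h₂₃ u hu v hv hu1 hv1 (Or.inr huv) r' hr').resolve_right hvr'
    refine hvr' (hG.adj_of_four_cycle huv hvr (hR hr hr' ?_) hur'.symm ?_ ?_ hur)
    · rintro rfl; exact hur hur'
    · rintro rfl; exact ((hcov _).1 hr).2.1 hu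
    · rintro rfl; exact ((hcov _).1 hr').2.2 hv
  -- Every edge between `Q₂` and `Q₃` outside `Q₁` needs an end in `Q₄`. The definitions are
  -- asymmetric on purpose: the neighbour `w` of `v` with `¬ C w` is what forces `U₂` and `U₃` to be
  -- joined completely.
  let U₂ : V → Prop := fun v => C v ∧ v ∈ Q₂ ∧ ∃ w ∈ Q₃, w ∉ Q₁ ∧ G.Adj v w ∧ ¬ C w
  let U₃ : V → Prop := fun v => C v ∧ v ∈ Q₃ ∧ ∃ w ∈ Q₂, w ∉ Q₁ ∧ G.Adj w v
  let Q₄ : V → Prop := fun v => v ∈ R ∨ (C v ∧ v ∈ Q₂ ∧ v ∈ Q₃) ∨ U₂ v ∨ U₃ v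
  have hU : ∀ u v, U₂ u → U₃ v → u ≠ v → G.Adj u v := by
    rintro u v' ⟨hu, hu2, v, hv3, hv1, huv, hv⟩ ⟨hv', hv3', u', hu2', hu1', huv'⟩ hne
    by_contra hn
    simp only [C, not_and, not_forall] at hv
    obtain ⟨r, hr, hvr⟩ := hv hv1
    have hvv' : v ≠ v' := by rintro rfl; exact hn huv
    exact hvr (hG.adj_of_four_cycle huv (hQ₃ hv3 hv3' hvv') (hv'.2 r hr) (hu.2 r hr).symm hne
      (fun h => ((hcov r).1 hr).2.2 (h ▸ hv3)) hn)
  have hQ₄ : ∀ u v, Q₄ u → Q₄ v → u ≠ v → G.Adj u v := by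
    have h22 : ∀ u v, u ∈ Q₂ → v ∈ Q₂ → u ≠ v → G.Adj u v := fun u v h h' => hQ₂ h h'
    have h33 : ∀ u v, u ∈ Q₃ → v ∈ Q₃ → u ≠ v → G.Adj u v := fun u v h h' => hQ₃ h h'
    intro u v hu hv hne
    have hC : ∀ v, Q₄ v → v ∈ R ∨ C v := by
      rintro v (h | h | h | h)
      exacts [Or.inl h, Or.inr h.1, Or.inr h.1, Or.inr h.1]
    by_cases huR : u ∈ R
    · rcases hC v hv with hvR | hvC
      · exact hR huR hvR hne
      · exact (hvC.2 u huR).symm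
    by_cases hvR : v ∈ R
    · exact ((hC u hu).resolve_left huR).2 v hvR
    rcases hu.resolve_left huR with hu | hu | hu <;> rcases hv.resolve_left hvR with hv | hv | hv
    · exact h22 u v hu.2.1 hv.2.1 hne
    · exact h22 u v hu.2.1 hv.2.1 hne
    · exact h33 u v hu.2.2 hv.2.1 hne
    · exact h22 u v hu.2.1 hv.2.1 hne
    · exact h22 u v hu.2.1 hv.2.1 hne
    · exact hU u v hu hv hne
    · exact h33 u v hu.2.1 hv.2.2 hne
    · exact (hU v u hv hu hne.symm).symm
    · exact h33 u v hu.2.1 hv.2.1 hne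
  have hQ₄₁ : ∀ v, Q₄ v → v ∉ Q₁ := by
    rintro v (h | h | h | h)
    exacts [((hcov v).1 h).1, h.1.1, h.1.1, h.1.1]
  have h₂₃₄ : ∀ v ∈ Q₂, v ∈ Q₃ → v ∉ Q₁ → Q₄ v := fun v h2 h3 h1 =>
    Or.inr (Or.inl ⟨⟨h1, fun r hr => (or_self_iff.1 (h₂₃ v h2 v h3 h1 h1 (Or.inl rfl) r hr))⟩,
      h2, h3⟩)
  have hedge : ∀ u ∈ Q₂, ∀ v ∈ Q₃, u ∉ Q₁ → v ∉ Q₁ → G.Adj u v → Q₄ u ∨ Q₄ v := by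
    intro u hu v hv hu1 hv1 huv
    by_cases hvC : C v
    · exact Or.inr (Or.inr (Or.inr (Or.inr ⟨hvC, hv, u, hu, hu1, huv⟩)))
    · exact Or.inl (Or.inr (Or.inr (Or.inl ⟨(hcomp u hu v hv hu1 hv1 huv).resolve_right hvC,
        hu, v, hv, hv1, huv, hvC⟩)))
  have hQ₄R : ∀ v, Q₄ v → v ∉ Q₂ → v ∉ Q₃ → v ∈ R := by
    rintro v (h | h | h | h) h2 h3
    exacts [h, absurd h.2.1 h2, absurd h.2.1 h2, absurd h.2.1 h3]
  -- The circular order puts `Q₄` opposite to `Q₁`, and `Q₂` opposite to `Q₃`.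
  let F : V → ZMod 4 → Prop := fun v =>
    ![v ∈ Q₁, v ∈ Q₂, Q₄ v, v ∈ Q₃]
  have hF0 : ∀ v, F v 0 ↔ v ∈ Q₁ := fun v => Iff.rfl
  have hF1 : ∀ v, F v 1 ↔ v ∈ Q₂ := fun v => Iff.rfl
  have hF2 : ∀ v, F v 2 ↔ Q₄ v := fun v => Iff.rfl
  have hF3 : ∀ v, F v 3 ↔ v ∈ Q₃ := fun v => Iff.rfl
  have hall : ∀ i : ZMod 4, i = 0 ∨ i = 1 ∨ i = 2 ∨ i = 3 := by decide
  have hcov' : ∀ v, v ∈ Q₁ ∨ v ∈ Q₂ ∨ Q₄ v ∨ v ∈ Q₃ := by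
    intro v
    have := hcov v
    have h4 : v ∈ R → Q₄ v := Or.inl
    tauto
  refine hG.isCircularArc_of_cyclic_cover F ?_ ?_ ?_
  · intro v
    obtain ⟨a, k, h⟩ := exists_cyclic_interval (fun i => decide (F v i)) (by
        simp only [decide_eq_true_eq]
        rcases hcov' v with h | h | h | h
        exacts [⟨0, h⟩, ⟨1, h⟩, ⟨2, h⟩, ⟨3, h⟩])
      (by
        simp only [decide_eq_true_eq, hF0, hF2]
        exact fun h => hQ₄₁ v h.2 h.1)
      (by
        simp only [decide_eq_true_eq, decide_eq_false_iff_not, hF0, hF1, hF2, hF3]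
        exact fun ⟨h0, h1, h2, h3⟩ => h2 (h₂₃₄ v h1 h3 h0))
    refine ⟨a, k, by omega, fun i => ?_⟩
    rw [← decide_eq_true_eq (p := F v i), h i]
    constructor
    · rintro ⟨j, hj, rfl⟩
      exact ⟨j, hj, rfl⟩
    · rintro ⟨j, hj, rfl⟩
      exact ⟨⟨j, by omega⟩, hj, rfl⟩
  · intro i u v hu hv huv
    rcases hall i with rfl | rfl | rfl | rfl
    exacts [hQ₁ hu hv huv, hQ₂ hu hv huv, hQ₄ u v hu hv huv, hQ₃ hu hv huv]
  · have key : ∀ u v, G.Adj u v → F u 0 ∧ F v 2 →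
        (F u 1 ∨ F u 2 ∨ F u 3) ∨ F v 0 ∨ F v 1 ∨ F v 3 := by
      rintro u v huv ⟨hu, hv⟩
      by_contra hcon
      push Not at hcon
      exact h₁ u hu hcon.1.1 hcon.1.2.2 v (hQ₄R v hv hcon.2.2.1 hcon.2.2.2) huv
    have key' : ∀ u v, G.Adj u v → F u 1 ∧ F v 3 →
        (F u 0 ∨ F u 2 ∨ F u 3) ∨ F v 0 ∨ F v 1 ∨ F v 2 := by
      rintro u v huv ⟨hu, hv⟩
      by_contra hcon
      push Not at hcon
      rcases hedge u hu v hv hcon.1.1 hcon.2.1 huv with h | h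
      exacts [hcon.1.2.1 h, hcon.2.2.2 h]
    intro u v huv
    have k1 := key u v huv
    have k2 := key v u huv.symm
    have k3 := key' u v huv
    have k4 := key' v u huv.symm
    have cu : F u 0 ∨ F u 1 ∨ F u 2 ∨ F u 3 := hcov' u
    have cv : F v 0 ∨ F v 1 ∨ F v 2 ∨ F v 3 := hcov' v
    by_contra hno
    push Not at hno
    have n0 := hno 0
    have n1 := hno 1
    have n2 := hno 2
    have n3 := hno 3
    have e1 : (0 + 1 : ZMod 4) = 1 := rfl
    have e2 : (1 + 1 : ZMod 4) = 2 := rfl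
    have e3 : (2 + 1 : ZMod 4) = 3 := rfl
    have e4 : (3 + 1 : ZMod 4) = 0 := rfl
    rw [e1] at n0
    rw [e2] at n1
    rw [e3] at n2
    rw [e4] at n3
    clear hno key key' e1 e2 e3 e4
    generalize F u 0 = a0 at *
    generalize F u 1 = a1 at *
    generalize F u 2 = a2 at *
    generalize F u 3 = a3 at *
    generalize F v 0 = b0 at *
    generalize F v 1 = b1 at *
    generalize F v 2 = b2 at *
    generalize F v 3 = b3 at *
    grind

/-! ### Three independent simplicial vertices -/

theorem Walk.exists_isPath_misses {x y z w : V} (p : G.Walk x y) (hz : G.Misses z p)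
    (hw : G.Misses w p) : ∃ p : G.Walk x y, p.IsPath ∧ G.Misses z p ∧ G.Misses w p := by
  classical
  exact ⟨p.bypass, p.bypass_isPath, fun u hu => hz u (p.support_bypass_subset_support hu),
    fun u hu => hw u (p.support_bypass_subset_support hu)⟩

theorem exists_walk_of_closed_neighbors {x y u v : V} (hxu : u = x ∨ G.Adj x u)
    (huv : u = v ∨ G.Adj u v) (hvy : v = y ∨ G.Adj y v) :
    ∃ p : G.Walk x y, ∀ w ∈ p.support, w = x ∨ w = u ∨ w = v ∨ w = y := by
  have step : ∀ a b : V, (b = a ∨ G.Adj a b) →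
      ∃ p : G.Walk a b, ∀ w ∈ p.support, w = a ∨ w = b := by
    rintro a b (rfl | h)
    · exact ⟨Walk.nil, by simp⟩
    · exact ⟨h.toWalk, by simp⟩
  obtain ⟨p, hp⟩ := step x u hxu
  obtain ⟨q, hq⟩ := step u v (huv.imp_left Eq.symm)
  obtain ⟨r, hr⟩ := step v y (hvy.imp Eq.symm SimpleGraph.Adj.symm)
  refine ⟨(p.append q).append r, fun w hw => ?_⟩
  simp only [Walk.mem_support_append_iff] at hw
  rcases hw with (hw | hw) | hw
  · have := hp w hw; tauto
  · have := hq w hw; tauto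
  · have := hr w hw; tauto

theorem Avoid.symm {x y z w : V} (h : G.Avoid x y z w) : G.Avoid z w x y := Or.symm h

theorem Avoid.swap_right {x y z w : V} (h : G.Avoid x y z w) : G.Avoid x y w z := by
  rcases h with ⟨p, hp, hz, hw⟩ | ⟨p, hp, hx, hy⟩
  · exact Or.inl ⟨p, hp, hw, hz⟩
  · refine Or.inr ⟨p.reverse, hp.reverse, fun u hu => hx u ?_, fun u hu => hy u ?_⟩ <;>
      simpa using hu

/-- The closed neighbourhood of a vertex. -/
def closedNbhd (G : SimpleGraph V) (x : V) : Set V := {v | v = x ∨ G.Adj x v}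

theorem mem_closedNbhd {x v : V} : v ∈ G.closedNbhd x ↔ v = x ∨ G.Adj x v := Iff.rfl

theorem IsSimplicialIn.isClique_closedNbhd {x : V} (h : G.IsSimplicialIn Set.univ x) :
    G.IsClique (G.closedNbhd x) := by
  rintro a (rfl | ha) b (rfl | hb) hab
  · exact absurd rfl hab
  · exact hb
  · exact ha.symm
  · exact h.2 a trivial b trivial ha hb hab

/-- A chordal graph is a circular-arc graph if the vertices that miss the independent simplicial
vertices `x`, `y`, `z` form a clique `R`, and for some `r` in `R` the vertices `x, r` do not avoid
`y, z` and `R` is hit completely by the connections between the neighbourhoods of `y` and `z` that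
hit `r`. -/
theorem IsChordal.isCircularArc_of_not_avoid [Finite V] (hG : G.IsChordal) {x y z r : V}
    (hx : G.IsSimplicialIn Set.univ x) (hy : G.IsSimplicialIn Set.univ y)
    (hz : G.IsSimplicialIn Set.univ z) (hxy : x ∉ G.closedNbhd y) (hxz : x ∉ G.closedNbhd z)
    (hyz : y ∉ G.closedNbhd z)
    {R : Set V} (hR : G.IsClique R)
    (hcov : ∀ v, v ∈ R ↔ v ∉ G.closedNbhd x ∧ v ∉ G.closedNbhd y ∧ v ∉ G.closedNbhd z)
    (hr : r ∈ R) (hna : ¬ G.Avoid x r y z)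
    (hmin : ∀ u ∈ G.closedNbhd y, ∀ v ∈ G.closedNbhd z, (u = v ∨ G.Adj u v) →
      G.Adj u r ∨ G.Adj v r → ∀ r' ∈ R, G.Adj u r' ∨ G.Adj v r') : G.IsCircularArc := by
  simp only [mem_closedNbhd, not_or] at hxy hxz hyz
  have hr' := (hcov r).1 hr
  simp only [mem_closedNbhd, not_or] at hr'
  refine hG.isCircularArc_of_three_cliques hx.isClique_closedNbhd hy.isClique_closedNbhd
    hz.isClique_closedNbhd hR hcov ?_ ?_
  · intro u hu v hv hu1 hv1 huv
    refine hmin u hu v hv huv ?_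
    by_contra hcon
    push Not at hcon
    -- If `r` did not hit `u, v`, the walk `y, u, v, z` would be missed by `x` and `r`.
    obtain ⟨p, hp⟩ := exists_walk_of_closed_neighbors hu huv hv
    refine hna (Or.inr (p.exists_isPath_misses ?_ ?_))
    · intro w hw
      rcases hp w hw with rfl | rfl | rfl | rfl
      · exact fun h => hxy.2 h.symm
      · exact fun h => hu1 (Or.inr h)
      · exact fun h => hv1 (Or.inr h)
      · exact fun h => hxz.2 h.symm
    · intro w hw
      rcases hp w hw with rfl | rfl | rfl | rfl
      · exact fun h => hr'.2.1.2 h.symm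
      · exact fun h => hcon.1 h.symm
      · exact fun h => hcon.2 h.symm
      · exact fun h => hr'.2.2.2 h.symm
  · intro u hu huy huz v hv huv
    have hv' := (hcov v).1 hv
    have hvr : v = r ∨ G.Adj r v := by
      by_cases h : v = r
      · exact Or.inl h
      · exact Or.inr (hR hr hv (Ne.symm h))
    -- The walk `x, u, v, r` would be missed by `y` and `z`.
    obtain ⟨p, hp⟩ := exists_walk_of_closed_neighbors hu (Or.inr huv) hvr
    refine hna (Or.inl (p.exists_isPath_misses ?_ ?_))
    · intro w hw
      rcases hp w hw with rfl | rfl | rfl | rfl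
      · exact hxy.2
      · exact fun h => huy (Or.inr h)
      · exact fun h => hv'.2.1 (Or.inr h)
      · exact hr'.2.1.2
    · intro w hw
      rcases hp w hw with rfl | rfl | rfl | rfl
      · exact hxz.2
      · exact fun h => huz (Or.inr h)
      · exact fun h => hv'.2.2 (Or.inr h)
      · exact hr'.2.2.2

/-- Let `r` and `r'` be adjacent, and let `{a, b}` and `{a', b'}` be connected sets that meet a
common clique. If `r` hits only the second set and `r'` hits the first one, then `r'` hits
the second one, too. -/
theorem IsChordal.adj_of_touching_pairs (hG : G.IsChordal) {Q : Set V} (hQ : G.IsClique Q)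
    {r r' a b a' b' : V} (hrr' : G.Adj r r') (hab : a = b ∨ G.Adj a b)
    (hab' : a' = b' ∨ G.Adj a' b') (ha : a ∈ Q) (ha' : a' ∈ Q) (har : a ≠ r) (hbr : b ≠ r)
    (ha'r : a' ≠ r) (ha'r' : a' ≠ r') (hb'r' : b' ≠ r') (hra : ¬ G.Adj r a) (hrb : ¬ G.Adj r b)
    (hit : G.Adj r a' ∨ G.Adj r b') (hit' : G.Adj r' a ∨ G.Adj r' b) :
    G.Adj r' a' ∨ G.Adj r' b' := by
  have hwalk : ∀ c, (c = a ∨ c = b) → ∃ p : G.Walk c a, ∀ w ∈ p.support, w ≠ r ∧ ¬ G.Adj r w := by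
    rintro c (rfl | rfl)
    · exact ⟨Walk.nil, by simpa using ⟨har, hra⟩⟩
    · rcases hab with rfl | hab
      · exact ⟨Walk.nil, by simpa using ⟨har, hra⟩⟩
      · exact ⟨hab.symm.toWalk, by simpa using ⟨⟨hbr, hrb⟩, har, hra⟩⟩
  obtain ⟨c, hc, hr'c⟩ : ∃ c, (c = a ∨ c = b) ∧ G.Adj r' c := by
    rcases hit' with h | h
    exacts [⟨a, Or.inl rfl, h⟩, ⟨b, Or.inr rfl, h⟩]
  -- The walk `p` contains no neighbour of `r`, while `r'` is a neighbour of `r` attached to it. So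
  -- is `a'` or, after prolonging `p` to `a'` if needed, `b'`.
  obtain ⟨p, hp⟩ := hwalk c hc
  by_cases hra' : G.Adj r a'
  · have haa' : a' ≠ a := by rintro rfl; exact hra hra'
    exact Or.inl (hG.adj_of_adj_walk hrr' hra' ha'r'.symm hr'c (hQ ha' ha haa') p hp)
  · have hrb' := hit.resolve_left hra'
    have hab' : G.Adj a' b' := hab'.resolve_left fun h => hra' (h ▸ hrb')
    refine Or.inr ?_
    by_cases haa' : a' = a
    · subst haa'
      exact hG.adj_of_adj_walk hrr' hrb' hb'r'.symm hr'c hab'.symm p hp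
    · refine hG.adj_of_adj_walk hrr' hrb' hb'r'.symm hr'c hab'.symm
        (p.concat (hQ ha ha' (Ne.symm haa'))) ?_
      intro w hw
      rw [Walk.support_concat, List.mem_append, List.mem_singleton] at hw
      rcases hw with hw | rfl
      exacts [hp w hw, ⟨ha'r, hra'⟩]

theorem IsChordal.isCircularArc_of_simplicial_triple [Finite V] (hG : G.IsChordal)
    (hα : G.indepNum ≤ 4) (hBQ : ¬ ∃ x y z w : V, G.IsBlockingQuadruple x y z w) {x : Fin 3 → V}
    (hs : ∀ i, G.IsSimplicialIn Set.univ (x i)) (hx : ∀ i j, i ≠ j → x i ∉ G.closedNbhd (x j)) :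
    G.IsCircularArc := by
  classical
  have := Fintype.ofFinite V
  let R : Set V := {v | ∀ i, v ∉ G.closedNbhd (x i)}
  -- Two non-adjacent vertices of `R` and the three `x i` would be five independent vertices.
  have hR : G.IsClique R := by
    intro r hr r' hr' hne
    by_contra hn
    have hxne : ∀ i j, i ≠ j → x i ≠ x j := fun i j h h' => hx i j h (Or.inl h')
    have hxadj : ∀ i j, ¬ G.Adj (x i) (x j) := by
      intro i j h
      by_cases hij : i = j
      · subst hij; exact h.ne rfl
      · exact hx j i (Ne.symm hij) (Or.inr h)
    have hrx : ∀ r ∈ R, ∀ i, r ≠ x i ∧ ¬ G.Adj (x i) r := fun r hr i =>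
      ⟨fun h => hr i (Or.inl h), fun h => hr i (Or.inr h)⟩
    let I : Finset V := insert r (insert r' (Finset.univ.image x))
    have hinj : Function.Injective x := fun i j h => by
      by_contra hij; exact hxne i j hij h
    have hcard : I.card = 5 := by
      rw [Finset.card_insert_of_notMem, Finset.card_insert_of_notMem,
        Finset.card_image_of_injective _ hinj]
      · rfl
      · simp only [Finset.mem_image, Finset.mem_univ, true_and, not_exists]
        exact fun i h => (hrx r' hr' i).1 h.symm
      · simp only [Finset.mem_insert, Finset.mem_image, Finset.mem_univ, true_and, not_or,
          not_exists]
        exact ⟨hne, fun i h => (hrx r hr i).1 h.symm⟩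
    have hind : G.IsIndepSet (I : Set V) := by
      have hmem : ∀ v, v ∈ (I : Set V) ↔ v = r ∨ v = r' ∨ ∃ i, x i = v := by simp [I]
      intro p hp q hq _
      rw [hmem] at hp hq
      rcases hp with rfl | rfl | ⟨i, rfl⟩ <;> rcases hq with rfl | rfl | ⟨j, rfl⟩
      · exact G.irrefl
      · exact hn
      · exact fun h => (hrx p hr j).2 h.symm
      · exact fun h => hn h.symm
      · exact G.irrefl
      · exact fun h => (hrx p hr' j).2 h.symm
      · exact (hrx q hr i).2
      · exact (hrx q hr' i).2
      · exact hxadj i j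
    have := hind.card_le_indepNum
    omega
  by_cases hRe : R = ∅
  · have hemp : ∀ r, r ∉ R := fun r => by rw [hRe]; exact Set.notMem_empty r
    refine hG.isCircularArc_of_three_cliques (hs 0).isClique_closedNbhd
      (hs 1).isClique_closedNbhd (hs 2).isClique_closedNbhd hR ?_
      (fun _ _ _ _ _ _ _ r hr => absurd hr (hemp r)) (fun _ _ _ _ r hr => absurd hr (hemp r))
    intro v
    simp [R, Fin.forall_fin_succ]
  let H : V → Finset (V × V) := fun r => Finset.univ.filter fun p =>
    (∃ i j, i ≠ j ∧ p.1 ∈ G.closedNbhd (x i) ∧ p.2 ∈ G.closedNbhd (x j)) ∧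
      (p.1 = p.2 ∨ G.Adj p.1 p.2) ∧ (G.Adj r p.1 ∨ G.Adj r p.2)
  have hH : ∀ r u v, (u, v) ∈ H r ↔
      (∃ i j, i ≠ j ∧ u ∈ G.closedNbhd (x i) ∧ v ∈ G.closedNbhd (x j)) ∧
      (u = v ∨ G.Adj u v) ∧ (G.Adj r u ∨ G.Adj r v) := by simp [H]
  have hRQ : ∀ r ∈ R, ∀ i, ∀ u ∈ G.closedNbhd (x i), u ≠ r := by
    rintro r hr i u hu rfl
    exact hr i hu
  have hchain : ∀ r ∈ R, ∀ r' ∈ R, H r ⊆ H r' ∨ H r' ⊆ H r := by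
    intro r hr r' hr'
    by_contra hcon
    rw [not_or, Finset.not_subset, Finset.not_subset] at hcon
    obtain ⟨⟨⟨u', v'⟩, h1, h2⟩, ⟨⟨u, v⟩, h3, h4⟩⟩ := hcon
    rw [hH] at h1 h2 h3 h4
    have hrr' : G.Adj r r' := hR hr hr' (by rintro rfl; exact h2 h1)
    obtain ⟨⟨i', j', hij', hu', hv'⟩, huv', hit⟩ := h1
    obtain ⟨⟨i, j, hij, hu, hv⟩, huv, hit'⟩ := h3
    have h2' : ¬ (G.Adj r' u' ∨ G.Adj r' v') := fun h => h2 ⟨⟨i', j', hij', hu', hv'⟩, huv', h⟩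
    have h4' : ¬ (G.Adj r u ∨ G.Adj r v) := fun h => h4 ⟨⟨i, j, hij, hu, hv⟩, huv, h⟩
    rw [not_or] at h4'
    have key : ∀ k a b a' b', a ∈ G.closedNbhd (x k) → a' ∈ G.closedNbhd (x k) →
        (∃ l, b ∈ G.closedNbhd (x l)) → (∃ l, b' ∈ G.closedNbhd (x l)) → (a = b ∨ G.Adj a b) →
        (a' = b' ∨ G.Adj a' b') → ¬ G.Adj r a → ¬ G.Adj r b → (G.Adj r a' ∨ G.Adj r b') →
        (G.Adj r' a ∨ G.Adj r' b) → G.Adj r' a' ∨ G.Adj r' b' := by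
      rintro k a b a' b' ha ha' ⟨l, hb⟩ ⟨l', hb'⟩ hab hab' hra hrb hit hit'
      exact hG.adj_of_touching_pairs (hs k).isClique_closedNbhd hrr' hab hab' ha ha'
        (hRQ r hr k a ha) (hRQ r hr l b hb) (hRQ r hr k a' ha') (hRQ r' hr' k a' ha')
        (hRQ r' hr' l' b' hb') hra hrb hit hit'
    -- Two pairs of indices out of three meet; the common index gives the clique that both touching
    -- pairs meet.
    have hshare : i = i' ∨ i = j' ∨ j = i' ∨ j = j' := by
      omega
    have huv1 : v = u ∨ G.Adj v u := huv.imp Eq.symm SimpleGraph.Adj.symm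
    have huv1' : v' = u' ∨ G.Adj v' u' := huv'.imp Eq.symm SimpleGraph.Adj.symm
    rcases hshare with rfl | rfl | rfl | rfl
    · exact h2' (key _ u v u' v' hu hu' ⟨_, hv⟩ ⟨_, hv'⟩ huv huv' h4'.1 h4'.2 hit hit')
    · exact h2' (key _ u v v' u' hu hv' ⟨_, hv⟩ ⟨_, hu'⟩ huv huv1' h4'.1 h4'.2 hit.symm hit').symm
    · exact h2' (key _ v u u' v' hv hu' ⟨_, hu⟩ ⟨_, hv'⟩ huv1 huv' h4'.2 h4'.1 hit hit'.symm)
    · exact h2' (key _ v u v' u' hv hv' ⟨_, hu⟩ ⟨_, hu'⟩ huv1 huv1' h4'.2 h4'.1 hit.symm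
        hit'.symm).symm
  obtain ⟨r, hr, hrmin⟩ := Set.exists_min_image R (fun r => (H r).card) R.toFinite
    (Set.nonempty_iff_ne_empty.2 hRe)
  have hHr : ∀ r' ∈ R, H r ⊆ H r' := by
    intro r' hr'
    rcases hchain r hr r' hr' with h | h
    · exact h
    · exact (Finset.eq_of_subset_of_card_le h (hrmin r' hr')).symm.subset
  have hmin : ∀ i j, i ≠ j → ∀ u ∈ G.closedNbhd (x i), ∀ v ∈ G.closedNbhd (x j),
      (u = v ∨ G.Adj u v) → G.Adj u r ∨ G.Adj v r → ∀ r' ∈ R, G.Adj u r' ∨ G.Adj v r' := by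
    intro i j hij u hu v hv huv h r' hr'
    have := hHr r' hr' ((hH r u v).2 ⟨⟨i, j, hij, hu, hv⟩, huv,
      h.imp SimpleGraph.Adj.symm SimpleGraph.Adj.symm⟩)
    exact ((hH _ _ _).1 this).2.2.imp SimpleGraph.Adj.symm SimpleGraph.Adj.symm
  have hmain : ∀ i j k : Fin 3, i ≠ j → i ≠ k → j ≠ k → ¬ G.Avoid (x i) r (x j) (x k) →
      G.IsCircularArc := by
    intro i j k hij hik hjk hna
    refine hG.isCircularArc_of_not_avoid (hs i) (hs j) (hs k) (hx i j hij) (hx i k hik)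
      (hx j k hjk) hR ?_ hr hna (hmin j k hjk)
    intro v
    have hall : ∀ l : Fin 3, l = i ∨ l = j ∨ l = k := by omega
    constructor
    · exact fun h => ⟨h i, h j, h k⟩
    · rintro ⟨h1, h2, h3⟩ l
      rcases hall l with rfl | rfl | rfl
      exacts [h1, h2, h3]
  by_contra hca
  have havoid : ∀ i j k : Fin 3, i ≠ j → i ≠ k → j ≠ k → G.Avoid (x i) r (x j) (x k) :=
    fun i j k hij hik hjk => by_contra fun h => hca (hmain i j k hij hik hjk h)
  have hxne : ∀ i j, i ≠ j → x i ≠ x j := fun i j h h' => hx i j h (Or.inl h')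
  have hxr : ∀ i, x i ≠ r := fun i h => hr i (Or.inl h.symm)
  refine hBQ ⟨x 0, r, x 1, x 2, ⟨hxr 0, hxne 0 1 (by decide), hxne 0 2 (by decide),
    (hxr 1).symm, (hxr 2).symm, hxne 1 2 (by decide)⟩,
    havoid 0 1 2 (by decide) (by decide) (by decide),
    (havoid 2 0 1 (by decide) (by decide) (by decide)).symm.swap_right,
    (havoid 1 0 2 (by decide) (by decide) (by decide)).symm.swap_right⟩

/-! ### Proof of the theorem -/

theorem IsChordal.isCircularArc [Finite V] (hG : G.IsChordal) (hα : G.indepNum ≤ 4)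
    (hBQ : ¬ ∃ x y z w : V, G.IsBlockingQuadruple x y z w) : G.IsCircularArc := by
  classical
  have := Fintype.ofFinite V
  by_cases hcomp : ∀ a b : V, a ≠ b → G.Adj a b
  · exact isCircularArc_of_interval_model (fun _ => 0) (fun _ => 0) (fun _ => le_rfl)
      fun u v huv => by simp [hcomp u v huv]
  push Not at hcomp
  obtain ⟨a, b, hab, hnab⟩ := hcomp
  obtain ⟨x, hx, -, -⟩ := hG.exists_isSimplicialIn Finset.univ a (Finset.mem_univ _) b
    (Finset.mem_univ _) hab.symm hnab
  by_cases h3 : ∀ a b c, G.IsSimplicialIn (Finset.univ : Finset V) a →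
      G.IsSimplicialIn (Finset.univ : Finset V) b → G.IsSimplicialIn (Finset.univ : Finset V) c →
      a ≠ b → b ≠ c → a ≠ c → G.Adj a b ∨ G.Adj b c ∨ G.Adj a c
  · obtain ⟨l, r, m, hlr, -, -, hadj⟩ := hG.exists_interval_model Finset.univ x hx h3
    exact isCircularArc_of_interval_model l r (fun v => hlr v (Finset.mem_univ v))
      fun u v => hadj u (Finset.mem_univ u) v (Finset.mem_univ v)
  · push Not at h3
    obtain ⟨p, q, s, hp, hq, hs, hpq, hqs, hps, h1, h2, h3⟩ := h3
    rw [Finset.coe_univ] at hp hq hs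
    refine hG.isCircularArc_of_simplicial_triple hα hBQ (x := ![p, q, s]) ?_ ?_
    · intro i
      fin_cases i
      exacts [hp, hq, hs]
    · have h1' := fun h => h1 (G.adj_symm h)
      have h2' := fun h => h2 (G.adj_symm h)
      have h3' := fun h => h3 (G.adj_symm h)
      intro i j hij
      fin_cases i <;> fin_cases j <;> simp [mem_closedNbhd] at hij ⊢ <;> grind

/-- Vertices that avoid each other are non-adjacent, so a blocking quadruple is independent; this
rules it out when `α ≤ 3`. -/
theorem IsBlockingQuadruple.four_le_indepNum [Finite V] {x y z w : V}
    (h : G.IsBlockingQuadruple x y z w) : 4 ≤ G.indepNum := by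
  classical
  obtain ⟨⟨hxy, hxz, hxw, hyz, hyw, hzw⟩, h1, h2, -⟩ := h
  have n1 := h1.not_adj
  have n2 := h2.not_adj
  have hind : G.IsIndepSet (({x, y, z, w} : Finset V) : Set V) := by
    intro p hp q hq hpq
    simp only [Finset.coe_insert, Finset.coe_singleton, Set.mem_insert_iff,
      Set.mem_singleton_iff] at hp hq
    have hcomm := G.adj_comm
    grind
  have hcard : ({x, y, z, w} : Finset V).card = 4 := by
    simp [hxy, hxz, hxw, hyz, hyw, hzw]
  have := hind.card_le_indepNum
  omega

end SimpleGraph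

theorem theorem2 {V : Type*} [Finite V] (G : SimpleGraph V) (hG : G.IsChordal) :
    (G.indepNum ≤ 4 →
      (G.IsCircularArc ↔ ¬ ∃ x y z w : V, G.IsBlockingQuadruple x y z w)) ∧
    (G.indepNum ≤ 3 → G.IsCircularArc) := by
  refine ⟨fun hα => ⟨fun h ⟨x, y, z, w, hq⟩ => h.not_isBlockingQuadruple hq,
    hG.isCircularArc hα⟩, fun hα => hG.isCircularArc (by omega) ?_⟩
  rintro ⟨x, y, z, w, hq⟩
  have := hq.four_le_indepNum
  omega
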